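/- For a permutation $\pi=\pi_1\pi_2\cdots\pi_n$ of $\{1,\dots,n\}$ put $\pi_0=\pi_{n+1}=0$. A letter $\pi_i$ ($1\le i\le n$) is a peak of type 1 if $\pi_{i-1}<\pi_i>\pi_{i+1}$ and $\pi_{i-1}\le\pi_{i+1}$; let $\mathsf{pk}_1(\pi)$ be the number of type-1 peaks of $\pi$. Let $$A(z;t)=\sum_{n\ge1}\Bigl(\sum_{\pi\in\mathcal S_n}z^{\mathsf{pk}_1(\pi)}\Bigr)\frac{t^n}{n!}\in\mathbb Q[z][[t]].$$ Then, in the ring $\mathbb Q[z][[t]]$ of formal power series in $t$ (where the denominator below is invertible), $$A(z;t)=\frac{e^{(z-1)t^2/2}}{1-\int_0^t e^{(z-1)x^2/2}\,dx}+(z-1)t-1.$$ -/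

import Mathlib

open scoped Polynomial PowerSeries

/-- The letter `π_i` of the permutation `π = π_1 π_2 ⋯ π_n` of `{1, …, n}`, for a position `i : ℕ`,
with the convention that letters outside the word are zero (so `π_0 = π_{n+1} = 0`).
`Fin n` is identified with `{1, …, n}` by `j ↦ j + 1`, both for positions and for values. -/
def permLetter {n : ℕ} (π : Equiv.Perm (Fin n)) (i : ℕ) : ℕ :=
  if h : 1 ≤ i ∧ i ≤ n then (π ⟨i - 1, by omega⟩ : ℕ) + 1 else 0

/-- The letter at position `i` (in `{1, …, n}`) is a peak: `π_{i-1} < π_i > π_{i+1}`. -/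
def IsPeak {n : ℕ} (π : Equiv.Perm (Fin n)) (i : ℕ) : Prop :=
  permLetter π (i - 1) < permLetter π i ∧ permLetter π (i + 1) < permLetter π i

/-- A peak `π_i` is of type 1 if `π_{i-1} ≤ π_{i+1}`. -/
def IsPeakOne {n : ℕ} (π : Equiv.Perm (Fin n)) (i : ℕ) : Prop :=
  IsPeak π i ∧ permLetter π (i - 1) ≤ permLetter π (i + 1)

instance decidableIsPeakOne {n : ℕ} (π : Equiv.Perm (Fin n)) : DecidablePred (IsPeakOne π) := fun i => by
  unfold IsPeakOne IsPeak
  infer_instance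

/-- The number of type 1 peaks of `π`. -/
def pkOne {n : ℕ} (π : Equiv.Perm (Fin n)) : ℕ :=
  ((Finset.Icc 1 n).filter (IsPeakOne π)).card

/-- The polynomial `∑_{π ∈ S_n} z ^ pk₁(π)`, where `z` is the polynomial variable. -/
noncomputable def peakOnePoly (n : ℕ) : ℚ[X] :=
  ∑ π : Equiv.Perm (Fin n), (Polynomial.X : ℚ[X]) ^ pkOne π

/-- `A(z;t) = ∑_{n ≥ 1} (∑_{π ∈ S_n} z ^ pk₁(π)) t ^ n / n!`, a formal power series in `t`
with coefficients in `ℚ[z]`. -/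
noncomputable def peakOneEGF : ℚ[X]⟦X⟧ :=
  PowerSeries.mk fun n => if n = 0 then 0 else ((n.factorial : ℚ)⁻¹) • peakOnePoly n

/-- The formal integral `∫_0^t f(x) dx` of `f = ∑ a_n t ^ n`, that is `∑ a_n t ^ (n+1) / (n+1)`. -/
noncomputable def formalIntegral (f : ℚ[X]⟦X⟧) : ℚ[X]⟦X⟧ :=
  PowerSeries.mk fun
    | 0 => 0
    | n + 1 => ((n + 1 : ℚ)⁻¹) • PowerSeries.coeff n f

theorem constantCoeff_formalIntegral (f : ℚ[X]⟦X⟧) :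
    PowerSeries.constantCoeff (formalIntegral f) = 0 := by
  rw [← PowerSeries.coeff_zero_eq_constantCoeff_apply, formalIntegral, PowerSeries.coeff_mk]

theorem derivative_formalIntegral (f : ℚ[X]⟦X⟧) :
    PowerSeries.derivative ℚ[X] (formalIntegral f) = f := by
  ext1 n
  have h : ((n : ℚ) + 1) ≠ 0 := by positivity
  have e : ((n : ℚ[X]) + 1) = Polynomial.C ((n : ℚ) + 1) := by simp
  rw [PowerSeries.coeff_derivative, formalIntegral, PowerSeries.coeff_mk, e]
  change ((n + 1 : ℚ)⁻¹ • PowerSeries.coeff n f) * Polynomial.C ((n : ℚ) + 1) = _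
  rw [Polynomial.smul_eq_C_mul, mul_right_comm, ← Polynomial.C_mul, inv_mul_cancel₀ h]
  simp

/-- The formal power series `(z - 1) t ^ 2 / 2`. -/
noncomputable def halfSq : ℚ[X]⟦X⟧ :=
  PowerSeries.C (Polynomial.C (1 / 2 : ℚ) * (Polynomial.X - 1)) * PowerSeries.X ^ 2

theorem hasSubst_halfSq : PowerSeries.HasSubst halfSq :=
  PowerSeries.HasSubst.of_constantCoeff_zero' (by simp [halfSq])

/-- The formal power series `e ^ ((z - 1) t ^ 2 / 2)`, the composition of the exponential series
with `(z - 1) t ^ 2 / 2` (a legitimate composition by `hasSubst_halfSq`). -/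
noncomputable def expHalfSq : ℚ[X]⟦X⟧ :=
  (PowerSeries.exp ℚ[X]).subst halfSq

/-!
The proof removes the smallest letter `m` of a word. In a word `σ m τ` preceded by a letter `a` and
followed by a letter `b`, both smaller than `m`, the letter `m` is a peak only if `σ` and `τ` are
empty; so the type 1 peaks are those of `σ`, read between `a` and `m`, together with those of `τ`,
read between `m` and `b` (`wordPkOne_append_cons`). This calls for a statistic with arbitrary small
boundary letters `a`, `b`. By induction, its distribution on the words on a given set depends only
on the number `n` of letters, except that for `n = 1` the only letter is a peak of type 1 exactly
when `a ≤ b` (`sum_wordsOf_pow_wordPkOne`).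

Let `F(t)` be the exponential generating function for `a > b`. The one for `a ≤ b` is then
`F(t) + (z - 1) t`; for `a = b = 0` and without its constant term it is `A(z;t)`. As `σ` is read
with `a < m` and `τ` with `m > b`, the decomposition says `F' = (F + (z - 1) t) F` with `F(0) = 1`.
The quotient of `E = e ^ ((z - 1) t ^ 2 / 2)` by `D = 1 - ∫ E` satisfies the same equation, because
`D' = -E` and `E' = (z - 1) t E` (`derivative_quotientSeries`). The equation determines the
coefficients recursively, so the combinatorial induction is run directly against the coefficients
of this quotient.
-/

/-! ### Type 1 peaks of words -/

/-- The number of type 1 peaks of the word `l` of natural numbers, when the letter `a` is put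
before it and the letter `b` after it. -/
def wordPkOne (a : ℕ) : List ℕ → ℕ → ℕ
  | [], _ => 0
  | x :: t, b =>
    (if (a < x ∧ t.headD b < x) ∧ a ≤ t.headD b then 1 else 0) + wordPkOne x t b

/-- The words in which every element of `s` occurs exactly once and no other letter occurs. -/
def wordsOf (s : Finset ℕ) : Finset (List ℕ) :=
  ⟨Multiset.lists s.1, Multiset.lists_nodup_finset s⟩

theorem mem_wordsOf {s : Finset ℕ} {l : List ℕ} :
    l ∈ wordsOf s ↔ l.Nodup ∧ ∀ x, x ∈ l ↔ x ∈ s := by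
  rw [wordsOf, Finset.mem_mk, Multiset.mem_lists_iff, Multiset.quot_mk_to_coe]
  constructor
  · intro h
    refine ⟨Multiset.coe_nodup.1 (h ▸ s.nodup), fun x => ?_⟩
    rw [← Multiset.mem_coe, ← h, Finset.mem_val]
  · rintro ⟨h, hx⟩
    refine (Multiset.Nodup.ext s.nodup (Multiset.coe_nodup.2 h)).2 fun x => ?_
    rw [Finset.mem_val, Multiset.mem_coe, hx]

theorem length_of_mem_wordsOf {s : Finset ℕ} {l : List ℕ} (h : l ∈ wordsOf s) :
    l.length = s.card := by
  obtain ⟨h1, h2⟩ := mem_wordsOf.1 h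
  rw [← List.toFinset_card_of_nodup h1]
  congr 1
  ext x
  simp [h2]

/-- A letter smaller than all its neighbours separates the peaks of the words on its two sides,
and can itself be a peak only if it is the whole word. -/
theorem wordPkOne_append_cons {m b : ℕ} (hb : b < m) (τ : List ℕ) (hτ : ∀ x ∈ τ, m < x) :
    ∀ (σ : List ℕ) (a : ℕ), (σ = [] → a < m) → (∀ x ∈ σ, m < x) →
      wordPkOne a (σ ++ m :: τ) b =
        wordPkOne a σ m + wordPkOne m τ b + if σ = [] ∧ τ = [] ∧ a ≤ b then 1 else 0
  | [], a, ha, _ => by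
    have ha := ha rfl
    cases τ with
    | nil => simp [wordPkOne, hb, ha]
    | cons y τ =>
      have := hτ y (by simp)
      simp [wordPkOne, this.le]
  | x :: σ, a, _, hσ => by
    have hx := hσ x (by simp)
    have ih := wordPkOne_append_cons hb τ hτ σ x
    cases σ with
    | nil =>
      -- The left neighbour of `m` is now `x > m`, so `m` is not a peak.
      cases τ with
      | nil => simp [wordPkOne, hx.le]
      | cons y τ =>
        have := hτ y (by simp)
        simp [wordPkOne, this.le]
    | cons y σ =>
      have ih := ih (by simp) (fun z hz => hσ z (by simp [hz]))
      rw [List.cons_append, wordPkOne, ih, wordPkOne.eq_2 a m x]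
      simp [add_assoc]

/-- For `m ∈ s`, a word on `s` is uniquely of the form `σ m τ`, where `σ` is
a word on a subset `u` of `s \ {m}` and `τ` a word on the complement of `u` in `s \ {m}`. -/
theorem sum_wordsOf_eq_sum_powerset {M : Type*} [AddCommMonoid M] {s : Finset ℕ} {m : ℕ}
    (hm : m ∈ s) (g : List ℕ → M) :
    ∑ l ∈ wordsOf s, g l =
      ∑ u ∈ (s.erase m).powerset, ∑ p ∈ wordsOf u ×ˢ wordsOf (s.erase m \ u),
        g (p.1 ++ m :: p.2) := by
  classical
  rw [Finset.sum_sigma']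
  symm
  refine Finset.sum_nbij (fun x => x.2.1 ++ m :: x.2.2) ?_ ?_ ?_ (fun _ _ => rfl)
  · rintro ⟨u, σ, τ⟩ h
    simp only [Finset.mem_sigma, Finset.mem_powerset, Finset.mem_product, mem_wordsOf] at h
    obtain ⟨hu, ⟨hσ, hσ'⟩, hτ, hτ'⟩ := h
    rw [mem_wordsOf]
    constructor
    · simp only [List.nodup_append, List.nodup_cons, List.mem_cons]
      refine ⟨hσ, ⟨by simp [hτ'], hτ⟩, ?_⟩
      rintro x hx y (rfl | hy) rfl
      · simpa using hu ((hσ' _).1 hx)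
      · exact (Finset.mem_sdiff.1 ((hτ' _).1 hy)).2 ((hσ' _).1 hx)
    · intro x
      have := @hu x
      simp only [List.mem_append, List.mem_cons, hσ', hτ', Finset.mem_sdiff,
        Finset.mem_erase] at this ⊢
      by_cases hxm : x = m
      · simp [hxm, hm]
      · by_cases hxu : x ∈ u
        · simp [hxu, (this hxu).2]
        · simp [hxm, hxu]
  · rintro ⟨u, σ, τ⟩ h ⟨u', σ', τ'⟩ h' heq
    simp only [Finset.mem_coe, Finset.mem_sigma, Finset.mem_powerset, Finset.mem_product,
      mem_wordsOf] at h h'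
    obtain ⟨hu, ⟨-, hσ⟩, -, hτ⟩ := h
    obtain ⟨-, ⟨-, hσ'⟩, -⟩ := h'
    have hmu : m ∉ u := fun hh => by simpa using hu hh
    have h1 : m ∉ σ := by rwa [hσ]
    have h2 : m ∉ τ := by simp [hτ]
    obtain ⟨rfl, -, rfl⟩ := (List.append_cons_inj_of_notMem h1 h2).1 heq
    obtain rfl : u = u' := by
      ext x
      rw [← hσ, hσ']
    rfl
  · intro l hl
    obtain ⟨hl, hl'⟩ := mem_wordsOf.1 (Finset.mem_coe.1 hl)
    obtain ⟨σ, τ, rfl⟩ := List.append_of_mem ((hl' m).2 hm)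
    simp only [List.nodup_append, List.nodup_cons, List.mem_cons] at hl
    obtain ⟨hσ, ⟨hmτ, hτ⟩, hd⟩ := hl
    refine ⟨⟨σ.toFinset, σ, τ⟩, ?_, rfl⟩
    simp only [Finset.mem_coe, Finset.mem_sigma, Finset.mem_powerset, Finset.mem_product,
      mem_wordsOf, Finset.mem_sdiff, Finset.mem_erase, List.mem_toFinset]
    refine ⟨fun x hx => ?_, ⟨hσ, fun _ => trivial⟩, hτ, fun x => ?_⟩
    · rw [List.mem_toFinset] at hx
      exact Finset.mem_erase.2 ⟨hd x hx m (Or.inl rfl), (hl' x).1 (by simp [hx])⟩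
    · rw [← hl', List.mem_append, List.mem_cons]
      constructor
      · intro hx
        exact ⟨⟨fun h => hmτ (h ▸ hx), Or.inr (Or.inr hx)⟩, fun h => hd x h x (Or.inr hx) rfl⟩
      · rintro ⟨⟨h1, h2 | h2 | h2⟩, h3⟩
        · exact absurd h2 h3
        · exact absurd h2 h1
        · exact h2

/-- The distribution of type 1 peaks on the words on `s`, with boundary letters `a` and `b` smaller
than all of `s`; the numbers `f n` are the values for `a > b`. It depends on `s` through its cardinality only, and on `a` and `b` only when `s`
is a singleton. -/
theorem sum_wordsOf_pow_wordPkOne {R : Type*} [CommRing R] (z : R) (f : ℕ → R) (h0 : f 0 = 1)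
    (hf : ∀ n, f (n + 1) = ∑ k ∈ Finset.range (n + 1),
      n.choose k • ((f k + if k = 1 then z - 1 else 0) * f (n - k))) (s : Finset ℕ) :
    ∀ a b : ℕ, (∀ x ∈ s, a < x) → (∀ x ∈ s, b < x) →
      ∑ l ∈ wordsOf s, z ^ wordPkOne a l b =
        f s.card + if s.card = 1 ∧ a ≤ b then z - 1 else 0 := by
  classical
  induction s using Finset.strongInduction with
  | H s ih =>
  intro a b ha hb
  rcases s.eq_empty_or_nonempty with rfl | hs
  · have : wordsOf ∅ = {[]} := by
      ext l
      simp only [mem_wordsOf, Finset.mem_singleton, Finset.notMem_empty, iff_false,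
        ← List.eq_nil_iff_forall_not_mem]
      exact ⟨fun h => h.2, fun h => ⟨h ▸ List.nodup_nil, h⟩⟩
    simp [this, wordPkOne, h0]
  obtain ⟨m, hm, hmin⟩ := s.exists_min_image id hs
  have hlt : ∀ x ∈ s.erase m, m < x := fun x hx =>
    lt_of_le_of_ne (hmin x (Finset.mem_of_mem_erase hx)) (Finset.ne_of_mem_erase hx).symm
  have hcard : s.card = (s.erase m).card + 1 := (Finset.card_erase_add_one hm).symm
  rw [sum_wordsOf_eq_sum_powerset hm]
  -- To the left of `m` the boundary letters are `a < m`, so a one-letter word counts as a peak of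
  -- type 1; to the right they are `m > b`, so it does not.
  have key : ∀ u ∈ (s.erase m).powerset,
      ∑ p ∈ wordsOf u ×ˢ wordsOf (s.erase m \ u), z ^ wordPkOne a (p.1 ++ m :: p.2) b =
        z ^ (if (s.erase m).card = 0 ∧ a ≤ b then 1 else 0) *
        ((f u.card + if u.card = 1 then z - 1 else 0) * f ((s.erase m).card - u.card)) := by
    intro u hu
    rw [Finset.mem_powerset] at hu
    have hsub : u ⊂ s := lt_of_le_of_lt hu (Finset.erase_ssubset hm)
    have hsub' : s.erase m \ u ⊂ s := lt_of_le_of_lt Finset.sdiff_subset (Finset.erase_ssubset hm)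
    have e1 := ih u hsub a m (fun x hx => ha x (hsub.1 hx)) (fun x hx => hlt x (hu hx))
    have e2 := ih _ hsub' m b (fun x hx => hlt x (Finset.sdiff_subset hx))
      (fun x hx => hb x (hsub'.1 hx))
    simp only [(ha m hm).le, and_true] at e1
    simp only [(hb m hm).not_ge, and_false, if_false, add_zero,
      Finset.card_sdiff_of_subset hu] at e2
    rw [← e1, ← e2, Finset.sum_mul_sum, ← Finset.sum_product', Finset.mul_sum]
    refine Finset.sum_congr rfl fun p hp => ?_
    obtain ⟨hp1, hp2⟩ := Finset.mem_product.1 hp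
    have l1 := length_of_mem_wordsOf hp1
    have l2 := length_of_mem_wordsOf hp2
    rw [Finset.card_sdiff_of_subset hu] at l2
    have hle := Finset.card_le_card hu
    have hiff : (p.1 = [] ∧ p.2 = [] ∧ a ≤ b) ↔ ((s.erase m).card = 0 ∧ a ≤ b) := by
      rw [← List.length_eq_zero_iff, ← List.length_eq_zero_iff, l1, l2]
      omega
    rw [wordPkOne_append_cons (hb m hm) p.2
      (fun x hx => hlt x (Finset.sdiff_subset (((mem_wordsOf.1 hp2).2 x).1 hx))) p.1 a
      (fun _ => ha m hm) (fun x hx => hlt x (hu (((mem_wordsOf.1 hp1).2 x).1 hx)))]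
    simp only [hiff]
    rw [pow_add, pow_add]
    ring
  rw [Finset.sum_congr rfl key, ← Finset.mul_sum, Finset.sum_powerset_apply_card
    (fun k => (f k + if k = 1 then z - 1 else 0) * f ((s.erase m).card - k)), ← hf, ← hcard]
  rcases Nat.eq_zero_or_pos (s.erase m).card with h | h
  · have h1 : f 1 = 1 := by simp [hf 0, h0]
    rw [hcard, h, h1]
    by_cases hab : a ≤ b <;> simp [hab]
  · have : s.card ≠ 1 := by omega
    simp [this, h.ne']

/-! ### From permutations to words -/

/-- Type 1 peaks counted by position: the `i`-th letter of `a l b` is compared with its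
neighbours. -/
theorem wordPkOne_eq_sum (b : ℕ) : ∀ (l : List ℕ) (a : ℕ),
    wordPkOne a l b = ∑ i ∈ Finset.range l.length,
      if ((a :: l ++ [b]).getD i 0 < (a :: l ++ [b]).getD (i + 1) 0 ∧
          (a :: l ++ [b]).getD (i + 2) 0 < (a :: l ++ [b]).getD (i + 1) 0) ∧
          (a :: l ++ [b]).getD i 0 ≤ (a :: l ++ [b]).getD (i + 2) 0 then 1 else 0
  | [], a => by simp [wordPkOne]
  | x :: t, a => by
    rw [wordPkOne, wordPkOne_eq_sum b t x, List.length_cons, Finset.sum_range_succ', add_comm]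
    congr 1
    cases t <;> simp

/-- The word `π₁ π₂ ⋯ πₙ` of a permutation. -/
def permWord {n : ℕ} (π : Equiv.Perm (Fin n)) : List ℕ :=
  List.ofFn fun i => (π i : ℕ) + 1

theorem permLetter_eq_getD {n : ℕ} (π : Equiv.Perm (Fin n)) (i : ℕ) :
    permLetter π i = (0 :: permWord π ++ [0]).getD i 0 := by
  rcases i with _ | i
  · simp [permLetter]
  · rw [permLetter, List.cons_append, List.getD_cons_succ]
    have hlen : (permWord π).length = n := by simp [permWord]
    by_cases h : i < n
    · rw [dif_pos ⟨by omega, by omega⟩, List.getD_append _ _ _ _ (by omega),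
        List.getD_eq_getElem _ _ (by omega)]
      simp [permWord]
    · rw [dif_neg (by omega), List.getD_append_right _ _ _ _ (by omega)]
      cases i - (permWord π).length <;> simp

theorem pkOne_eq_wordPkOne {n : ℕ} (π : Equiv.Perm (Fin n)) :
    pkOne π = wordPkOne 0 (permWord π) 0 := by
  have hlen : (permWord π).length = n := by simp [permWord]
  rw [wordPkOne_eq_sum, pkOne, Finset.card_filter, hlen, ← Finset.Ico_succ_right_eq_Icc,
    Order.succ_eq_add_one, Finset.sum_Ico_eq_sum_range, Nat.add_sub_cancel]
  refine Finset.sum_congr rfl fun i _ => ?_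
  simp only [IsPeakOne, IsPeak, ← permLetter_eq_getD, Nat.add_comm 1 i, Nat.add_sub_cancel]

theorem peakOnePoly_eq_sum_wordsOf (n : ℕ) :
    peakOnePoly n = ∑ l ∈ wordsOf (Finset.Icc 1 n), (Polynomial.X : ℚ[X]) ^ wordPkOne 0 l 0 := by
  rw [peakOnePoly]
  refine Finset.sum_bij (fun π _ => permWord π) ?_ ?_ ?_ ?_
  · intro π _
    rw [mem_wordsOf, permWord, List.nodup_ofFn]
    refine ⟨fun i j h => π.injective (Fin.ext (by simpa using h)), fun x => ?_⟩
    rw [List.mem_ofFn, Finset.mem_Icc]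
    constructor
    · rintro ⟨i, rfl⟩
      have := (π i).isLt
      omega
    · rintro ⟨h1, h2⟩
      refine ⟨π.symm ⟨x - 1, by omega⟩, ?_⟩
      simp only [Equiv.apply_symm_apply]
      omega
  · intro π _ ρ _ h
    have := List.ofFn_injective h
    ext i
    simpa using congrFun this i
  · intro l hl
    have hlen := length_of_mem_wordsOf hl
    rw [Nat.card_Icc, Nat.add_sub_cancel] at hlen
    subst hlen
    obtain ⟨hnd, hmem⟩ := mem_wordsOf.1 hl
    have hb : ∀ i : Fin l.length, 1 ≤ l.get i ∧ l.get i ≤ l.length := fun i =>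
      Finset.mem_Icc.1 ((hmem _).1 (l.get_mem i))
    let g : Fin l.length → Fin l.length := fun i => ⟨l.get i - 1, by have := hb i; omega⟩
    have hg : Function.Injective g := by
      intro i j h
      have h' : l.get i - 1 = l.get j - 1 := congrArg Fin.val h
      have := hb i
      have := hb j
      exact hnd.injective_get (by omega)
    refine ⟨Equiv.ofBijective g (Finite.injective_iff_bijective.1 hg), Finset.mem_univ _, ?_⟩
    refine Eq.trans ?_ (List.ofFn_get l)
    rw [permWord]
    congr 1
    funext i
    have := hb i
    simp only [Equiv.ofBijective_apply, g]
    omega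
  · intro π _
    rw [pkOne_eq_wordPkOne]

/-! ### The generating function -/

/-- The product rule over a general coefficient ring. Over `ℚ[X]`, rewriting with
`Derivation.leibniz` meets two algebra structures on `ℚ[X]⟦X⟧` that do not unify. -/
theorem powerSeries_derivative_mul {R : Type*} [CommSemiring R] (f g : R⟦X⟧) :
    PowerSeries.derivative R (f * g) =
      f * PowerSeries.derivative R g + g * PowerSeries.derivative R f :=
  Derivation.leibniz _ f g

theorem constantCoeff_expHalfSq : PowerSeries.constantCoeff expHalfSq = 1 := by
  have h : PowerSeries.exp ℚ[X] = 1 + (PowerSeries.exp ℚ[X] - 1) := by ring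
  have h1 : PowerSeries.constantCoeff halfSq = 0 := by simp [halfSq]
  have h2 : PowerSeries.constantCoeff ((PowerSeries.exp ℚ[X] - 1).subst halfSq) = 0 :=
    PowerSeries.constantCoeff_subst_eq_zero h1 _ (by simp)
  rw [expHalfSq, h, PowerSeries.subst_add hasSubst_halfSq, map_add, h2, add_zero,
    ← PowerSeries.coe_substAlgHom hasSubst_halfSq, map_one, map_one]

theorem derivative_halfSq :
    PowerSeries.derivative ℚ[X] halfSq = PowerSeries.C (Polynomial.X - 1) * PowerSeries.X := by
  have h : (PowerSeries.C (Polynomial.C (1 / 2 : ℚ)) : ℚ[X]⟦X⟧) * 2 = 1 := by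
    rw [← map_ofNat (PowerSeries.C.comp Polynomial.C : ℚ →+* ℚ[X]⟦X⟧) 2, RingHom.comp_apply,
      ← map_mul, ← map_mul]
    norm_num
  rw [halfSq, powerSeries_derivative_mul, PowerSeries.derivative_C, PowerSeries.derivative_pow,
    PowerSeries.derivative_X, map_mul]
  push_cast
  linear_combination (PowerSeries.C (Polynomial.X - 1) * PowerSeries.X) * h

theorem derivative_expHalfSq :
    PowerSeries.derivative ℚ[X] expHalfSq =
      PowerSeries.C (Polynomial.X - 1) * PowerSeries.X * expHalfSq := by
  rw [expHalfSq, PowerSeries.derivative_subst hasSubst_halfSq, PowerSeries.derivative_exp,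
    derivative_halfSq, mul_comm]

theorem isUnit_one_sub_formalIntegral : IsUnit (1 - formalIntegral expHalfSq) := by
  rw [PowerSeries.isUnit_iff_constantCoeff]
  simp [constantCoeff_formalIntegral]

/-- The quotient of `e ^ ((z - 1) t ^ 2 / 2)` by `1 - ∫_0^t e ^ ((z - 1) x ^ 2 / 2) dx`. -/
noncomputable def quotientSeries : ℚ[X]⟦X⟧ :=
  expHalfSq * Ring.inverse (1 - formalIntegral expHalfSq)

theorem quotientSeries_mul :
    quotientSeries * (1 - formalIntegral expHalfSq) = expHalfSq := by
  rw [quotientSeries, mul_assoc, Ring.inverse_mul_cancel _ isUnit_one_sub_formalIntegral, mul_one]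

theorem constantCoeff_quotientSeries : PowerSeries.constantCoeff quotientSeries = 1 := by
  have h := congrArg PowerSeries.constantCoeff quotientSeries_mul
  simpa [constantCoeff_formalIntegral, constantCoeff_expHalfSq] using h

/-- The Riccati equation `F' = (F + (z - 1) t) F`. -/
theorem derivative_quotientSeries :
    PowerSeries.derivative ℚ[X] quotientSeries =
      (quotientSeries + PowerSeries.C (Polynomial.X - 1) * PowerSeries.X) * quotientSeries := by
  have h := congrArg (PowerSeries.derivative ℚ[X]) quotientSeries_mul
  rw [powerSeries_derivative_mul, map_sub, PowerSeries.derivative_one, derivative_formalIntegral,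
    derivative_expHalfSq] at h
  refine isUnit_one_sub_formalIntegral.mul_right_cancel ?_
  linear_combination h - (quotientSeries + PowerSeries.C (Polynomial.X - 1) * PowerSeries.X) *
    quotientSeries_mul

/-- The Riccati equation `derivative_quotientSeries` read off at the coefficients `n! [tⁿ] F`. -/
theorem factorial_smul_coeff_quotientSeries_succ (n : ℕ) :
    ((n + 1).factorial : ℚ) • PowerSeries.coeff (n + 1) quotientSeries =
      ∑ k ∈ Finset.range (n + 1), n.choose k •
        (((k.factorial : ℚ) • PowerSeries.coeff k quotientSeries +
            if k = 1 then (Polynomial.X : ℚ[X]) - 1 else 0) *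
          (((n - k).factorial : ℚ) • PowerSeries.coeff (n - k) quotientSeries)) := by
  have h := congrArg (PowerSeries.coeff n) derivative_quotientSeries
  rw [PowerSeries.coeff_derivative, PowerSeries.coeff_mul,
    Finset.Nat.sum_antidiagonal_eq_sum_range_succ_mk] at h
  have hl : ((n + 1).factorial : ℚ) • PowerSeries.coeff (n + 1) quotientSeries =
      (n.factorial : ℚ) • (PowerSeries.coeff (n + 1) quotientSeries * ((n : ℚ[X]) + 1)) := by
    rw [Nat.factorial_succ, Polynomial.smul_eq_C_mul, Polynomial.smul_eq_C_mul]
    push_cast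
    simp only [map_mul, map_add, map_natCast, map_one]
    ring
  rw [hl, h, Finset.smul_sum]
  refine Finset.sum_congr rfl fun k hk => ?_
  have hkn : k ≤ n := Nat.lt_succ_iff.1 (Finset.mem_range.1 hk)
  have hX : PowerSeries.coeff k
      ((PowerSeries.C ((Polynomial.X : ℚ[X]) - 1)) * PowerSeries.X) =
      if k = 1 then (Polynomial.X : ℚ[X]) - 1 else 0 := by
    rw [PowerSeries.coeff_C_mul, PowerSeries.coeff_X]
    split_ifs <;> simp
  -- The correction term lives at `k = 1`, where `k! = 1`.
  have hk1 : (k.factorial : ℚ[X]) * (if k = 1 then (Polynomial.X : ℚ[X]) - 1 else 0) =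
      if k = 1 then (Polynomial.X : ℚ[X]) - 1 else 0 := by
    split_ifs with hk1 <;> simp [hk1]
  have hfac : (n.factorial : ℚ[X]) = n.choose k * k.factorial * (n - k).factorial := by
    rw [← Nat.choose_mul_factorial_mul_factorial hkn]
    push_cast
    ring
  rw [map_add, hX]
  simp only [Polynomial.smul_eq_C_mul, nsmul_eq_mul, map_natCast, hfac]
  linear_combination (n.choose k * (n - k).factorial *
    PowerSeries.coeff (n - k) quotientSeries) * hk1

theorem peakOnePoly_eq (n : ℕ) :
    peakOnePoly n = (n.factorial : ℚ) • PowerSeries.coeff n quotientSeries +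
      if n = 1 then (Polynomial.X : ℚ[X]) - 1 else 0 := by
  rw [peakOnePoly_eq_sum_wordsOf, sum_wordsOf_pow_wordPkOne (Polynomial.X : ℚ[X])
    (fun k => (k.factorial : ℚ) • PowerSeries.coeff k quotientSeries)
    (by simp [constantCoeff_quotientSeries]) factorial_smul_coeff_quotientSeries_succ
    (Finset.Icc 1 n) 0 0
    (fun x hx => (Finset.mem_Icc.1 hx).1) (fun x hx => (Finset.mem_Icc.1 hx).1)]
  simp

/-- The denominator is invertible in `ℚ[z]⟦t⟧`, and `A(z;t)` is the quotient plus `(z - 1) t - 1`;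
`PowerSeries.X` is `t` and `Polynomial.X` is `z`. -/
theorem mainTheorem12 :
    IsUnit (1 - formalIntegral expHalfSq) ∧
    peakOneEGF =
      expHalfSq * Ring.inverse (1 - formalIntegral expHalfSq)
        + PowerSeries.C ((Polynomial.X : ℚ[X]) - 1) * PowerSeries.X - 1 := by
  refine ⟨isUnit_one_sub_formalIntegral, ?_⟩
  rw [← quotientSeries]
  ext1 n
  rw [peakOneEGF, PowerSeries.coeff_mk, peakOnePoly_eq, map_sub, map_add, PowerSeries.coeff_C_mul,
    PowerSeries.coeff_X, PowerSeries.coeff_one]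
  rcases eq_or_ne n 0 with rfl | hn
  · simp [constantCoeff_quotientSeries]
  have hfac : (n.factorial : ℚ) ≠ 0 := by positivity
  rw [if_neg hn, if_neg hn, smul_add, inv_smul_smul₀ hfac, sub_zero]
  congr 1
  split_ifs with h1 <;> simp [h1]
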